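/- Let $p\ge 1$ be an integer, $n_0=\lceil\log_2(8p)\rceil$, $h_0=2^{-n_0}$. For $0<\gamma\le 1$ let $\Delta_\gamma=\{(u,v):0<u<\gamma,\ 0<v<u\}$, $\Delta=\Delta_1$, and let $\mathbf u(s,t)=(s,st)$, a bijection $]0,1[^2\to\Delta$. **Mesh.** Let $\mathrm T_n$ be the set of the images under $\mathbf u$ of the open squares $]i2^{-n},(i+1)2^{-n}[\,\times\,]j2^{-n},(j+1)2^{-n}[$, $0\le i,j<2^n$. Put $\widehat{\mathrm T}_0=\{\Delta\}$ and, for $n\ge1$, $\widehat{\mathrm T}_n=\{\delta\in\mathrm T_n:\delta\subseteq\Delta\setminus\Delta_{1/2}\}\cup\{\tfrac12\delta:\delta\in\widehat{\mathrm T}_{n-1}\}$. **Spline space.** Let $b^n_i$, $1\le i\le 2^n+p$, be the B-splines of degree $p$ for the open knot vector $\xi^n_1\le\dots\le\xi^n_{2^n+2p+1}$ on $[0,1]$ with uniform mesh size $2^{-n}$. For $i\ge p+2$ put $m(i)=\lceil\log_2(i-p)\rceil$. For $1\le i\le p+1$ and $1\le j\le i$ let $\hat b^n_{i,j}(s,t)=b^n_i(s)\binom{i-1}{j-1}t^{j-1}(1-t)^{i-j}$;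 for $p+2\le i\le 2^n+p$ and $1\le j\le 2^{m(i)}+p$ let $\hat b^n_{i,j}(s,t)=b^n_i(s)\,b^{m(i)}_j(t)$. Put $\beta^n_{i,j}=\hat b^n_{i,j}\circ\mathbf u^{-1}$ and let $\widehat{\mathcal W}_n$ be the span of all $\beta^n_{i,j}$. For $\delta\in\widehat{\mathrm T}_n$, the support extension $\tilde\delta\subseteq\Delta$ is the union of the supports (closed relative to $\Delta$) of those $\beta^n_{i,j}$ whose support meets $\delta$. **Dual functionals.** Let $\lambda^n_k(f)=\int_{\xi^n_k}^{\xi^n_{k+p+1}}f\,D^{p+1}\psi^n_k\,dx$ be the standard (Schumaker) dual functionals of the $b^n_k$; here $$\psi^n_k(x)=g\Big(\frac{2x-\xi^n_k-\xi^n_{k+p+1}}{\xi^n_{k+p+1}-\xi^n_k}\Big)\frac{(x-\xi^n_{k+1})\cdots(x-\xi^n_{k+p})}{p!},\qquad g(x)=\int_{-1}^xB(y)\,dy,$$ and $B$ is the B-spline of degree $p$ with knots $\cos\frac{(p+1-i)\pi}{p+1}$, $0\le i\le p+1$, normalized to integral $1$. Let $\mu_{k,l}:L^2(\Delta_{h_0})\to\mathbb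 R$, $1\le k\le p+1$, $1\le l\le k$, be any fixed bounded linear functionals with $\mu_{k,l}(\beta^{n_0}_{i,j})=\delta_{ki}\delta_{lj}$ for all $i,j$. For $n\ge n_0$ and $\varphi\in L^2(\Delta)$ set $\Lambda^n_{k,l}(\varphi)=\mu_{k,l}(\varphi(2^{n_0-n}\,\cdot\,))$ if $k\le p+1$, $\Lambda^n_{k,l}(\varphi)=(\lambda^n_k\otimes\lambda^{m(k)}_l)(\varphi\circ\mathbf u)$ if $k\ge p+2$, and $$\Pi_{\widehat{\mathcal W}_n}\varphi=\sum_{k,l}\Lambda^n_{k,l}(\varphi)\,\beta^n_{k,l}\in\widehat{\mathcal W}_n .$$ **Theorem.** There is a constant $C_S>0$, depending only on $p$ (and on the functionals $\mu_{k,l}$, which are fixed once and for all for each $p$), such that for all $n\ge n_0$, all $\varphi\in L^2(\Delta)$ and all $\delta\in\widehat{\mathrm T}_n$, $$\|\Pi_{\widehat{\mathcal W}_n}\varphi\|_{L^2(\delta)}\le C_S\,\|\varphi\|_{L^2(\tilde\delta)} .$$ -/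

import Mathlib

open MeasureTheory Set

namespace HierSpline

noncomputable section

/-! ### Univariate B-splines -/

/-- Cox-de Boor recursion: the `i`-th B-spline of degree `q` for the knot sequence `ξ`, with the
usual convention `x / 0 = 0` for repeated knots. -/
def bspline (ξ : ℕ → ℝ) : ℕ → ℕ → ℝ → ℝ
  | 0, i, x => if ξ i ≤ x ∧ x < ξ (i + 1) then 1 else 0
  | q + 1, i, x =>
      (x - ξ i) / (ξ (i + q + 1) - ξ i) * bspline ξ q i x +
        (ξ (i + q + 2) - x) / (ξ (i + q + 2) - ξ (i + 1)) * bspline ξ q (i + 1) x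

/-- The open knot vector of degree `p` on `[0,1]` with uniform mesh size `1 / 2 ^ n`:
the knots are numbered `1, …, 2 ^ n + 2 p + 1`; the first and the last `p + 1` of them are
`0` and `1`, respectively. -/
def knot (p n i : ℕ) : ℝ := max 0 (min 1 (((i : ℝ) - ((p : ℝ) + 1)) / 2 ^ n))

/-- The B-spline `b^n_i` of degree `p`, for `1 ≤ i ≤ 2 ^ n + p`. -/
def b (p n i : ℕ) : ℝ → ℝ := bspline (knot p n) p i

/-! ### The standard (Schumaker) dual basis for univariate B-splines -/

/-- The knots `cos ((p + 1 - i) π / (p + 1))`, `0 ≤ i ≤ p + 1`, of the perfect B-spline. -/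
def perfectKnot (p i : ℕ) : ℝ :=
  Real.cos (((p : ℝ) + 1 - (i : ℝ)) * Real.pi / ((p : ℝ) + 1))

/-- The perfect B-spline of degree `p` (order `p + 1`) on `[-1,1]`, normalized to integral one. -/
def perfectBspline (p : ℕ) (x : ℝ) : ℝ :=
  ((p : ℝ) + 1) / 2 * bspline (perfectKnot p) p 0 x

/-- The transition function: `0` to the left of `-1`, `1` to the right of `1`. -/
def transition (p : ℕ) (x : ℝ) : ℝ := ∫ y in (-1 : ℝ)..x, perfectBspline p y

/-- `ψ_k(x) = g((2 x - ξ_k - ξ_{k+p+1}) / (ξ_{k+p+1} - ξ_k)) (x - ξ_{k+1}) ⋯ (x - ξ_{k+p}) / p!`,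
where `g` is the transition function. -/
def dualPsi (p n k : ℕ) (x : ℝ) : ℝ :=
  transition p ((2 * x - knot p n k - knot p n (k + p + 1)) /
      (knot p n (k + p + 1) - knot p n k)) *
    ((∏ r ∈ Finset.Icc 1 p, (x - knot p n (k + r))) / (p.factorial : ℝ))

/-- The standard dual functional `λ^n_k` of the B-spline `b^n_k`:
`λ^n_k(f) = ∫_{ξ_k}^{ξ_{k+p+1}} f D^{p+1} ψ_k`. -/
def dualFunctional (p n k : ℕ) (f : ℝ → ℝ) : ℝ :=
  ∫ x in knot p n k..knot p n (k + p + 1), f x * iteratedDeriv (p + 1) (dualPsi p n k) x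

/-- The tensor product `λ^n_k ⊗ λ^m_l`: `λ^m_l` acts in the second variable, `λ^n_k` in the
first one. -/
def tensorDual (p n k m l : ℕ) (F : ℝ × ℝ → ℝ) : ℝ :=
  dualFunctional p n k fun s => dualFunctional p m l fun t => F (s, t)

/-! ### The triangle and its hierarchical mesh -/

/-- The triangle `Δ_γ = {(u, v) : 0 < u < γ, 0 < v < u}`; the triangle `Δ` is `tri 1`. -/
def tri (γ : ℝ) : Set (ℝ × ℝ) := {x | 0 < x.1 ∧ x.1 < γ ∧ 0 < x.2 ∧ x.2 < x.1}

/-- The singular parameterization `(s, t) ↦ (s, s t)`. -/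
def param (x : ℝ × ℝ) : ℝ × ℝ := (x.1, x.1 * x.2)

/-- The inverse `(u, v) ↦ (u, v / u)` of the parameterization. -/
def paramInv (x : ℝ × ℝ) : ℝ × ℝ := (x.1, x.2 / x.1)

/-- The Bézier mesh `T_n`: the image under the parameterization of the uniform mesh of (open)
squares with side `1 / 2 ^ n` of the unit square. -/
def mesh (n : ℕ) : Set (Set (ℝ × ℝ)) :=
  {δ | ∃ i j : ℕ, i < 2 ^ n ∧ j < 2 ^ n ∧
    δ = param '' (Ioo ((i : ℝ) / 2 ^ n) (((i : ℝ) + 1) / 2 ^ n) ×ˢ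
      Ioo ((j : ℝ) / 2 ^ n) (((j : ℝ) + 1) / 2 ^ n))}

/-- The hierarchical mesh `T̂_n`. -/
def hierMesh : ℕ → Set (Set (ℝ × ℝ))
  | 0 => {tri 1}
  | n + 1 => {δ | δ ∈ mesh (n + 1) ∧ δ ⊆ tri 1 \ tri (1 / 2)} ∪
      {δ | ∃ δ' ∈ hierMesh n, δ = (fun x : ℝ × ℝ => (1 / 2 : ℝ) • x) '' δ'}

/-! ### The hierarchical basis -/

/-- The refinement level `m(i) = ⌈log₂ (i - p)⌉` in the second variable, for `i ≥ p + 2`. -/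
def level (p i : ℕ) : ℕ := Nat.clog 2 (i - p)

/-- The number of basis functions with first index `i`. -/
def numCols (p i : ℕ) : ℕ := if i ≤ p + 1 then i else 2 ^ level p i + p

/-- The function `b̂^n_{i,j}` on the unit square: `b^n_i(s)` times the `j`-th Bernstein polynomial
of degree `i - 1` in `t` if `i ≤ p + 1`, and `b^n_i(s) b^{m(i)}_j(t)` if `i ≥ p + 2`. -/
def bHat (p n i j : ℕ) (x : ℝ × ℝ) : ℝ :=
  if i ≤ p + 1 then b p n i x.1 * (bernsteinPolynomial ℝ (i - 1) (j - 1)).eval x.2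
  else b p n i x.1 * b p (level p i) j x.2

/-- The basis function `β^n_{i,j}` on the triangle. -/
def beta (p n i j : ℕ) (x : ℝ × ℝ) : ℝ := bHat p n i j (paramInv x)

/-- The index set of the basis of the hierarchical spline space of level `n`. -/
def basisIndex (p n : ℕ) : Set (ℕ × ℕ) :=
  {q | 1 ≤ q.1 ∧ q.1 ≤ 2 ^ n + p ∧ 1 ≤ q.2 ∧ q.2 ≤ numCols p q.1}

/-- The support (relative to the triangle) of the basis function `β^n_{i,j}`. -/
def betaSupport (p n i j : ℕ) : Set (ℝ × ℝ) :=
  closure {x | x ∈ tri 1 ∧ beta p n i j x ≠ 0} ∩ tri 1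

/-- The support extension of `δ`: the union of the supports of all the basis functions whose
support meets `δ`. -/
def supportExtension (p n : ℕ) (δ : Set (ℝ × ℝ)) : Set (ℝ × ℝ) :=
  {x | ∃ q ∈ basisIndex p n,
    (betaSupport p n q.1 q.2 ∩ δ).Nonempty ∧ x ∈ betaSupport p n q.1 q.2}

/-! ### Dual functionals on the coarse level -/

/-- The coarse level `n₀ = ⌈log₂ (8 p)⌉`. -/
def nZero (p : ℕ) : ℕ := Nat.clog 2 (8 * p)

/-- The coarse mesh size `h₀ = 1 / 2 ^ n₀`. -/
def hZero (p : ℕ) : ℝ := 1 / 2 ^ nZero p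

lemma hZero_le_one (p : ℕ) : hZero p ≤ 1 := by
  unfold hZero
  exact div_le_one_of_le₀ (one_le_pow₀ (by norm_num)) (by positivity)

/-- The space `L²(Δ_γ)`. -/
abbrev L2 (γ : ℝ) : Type := Lp ℝ 2 ((volume : Measure (ℝ × ℝ)).restrict (tri γ))

lemma measurableSet_tri (γ : ℝ) : MeasurableSet (tri γ) := by
  unfold tri
  refine MeasurableSet.inter (measurableSet_lt measurable_const measurable_fst) ?_
  refine MeasurableSet.inter (measurableSet_lt measurable_fst measurable_const) ?_
  exact MeasurableSet.inter (measurableSet_lt measurable_const measurable_snd)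
    (measurableSet_lt measurable_snd measurable_fst)

lemma volume_tri_lt_top {γ : ℝ} : volume (tri γ) < ⊤ := by
  have h : tri γ ⊆ Icc (0 : ℝ) γ ×ˢ Icc (0 : ℝ) γ := by
    rintro ⟨u, v⟩ ⟨h1, h2, h3, h4⟩
    simp only [mem_prod, mem_Icc] at *
    exact ⟨⟨h1.le, h2.le⟩, h3.le, by linarith⟩
  exact (measure_mono h).trans_lt (isCompact_Icc.prod isCompact_Icc).measure_lt_top

lemma measurable_bspline (ξ : ℕ → ℝ) (q i : ℕ) : Measurable (bspline ξ q i) := by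
  induction q generalizing i with
  | zero =>
    have h : bspline ξ 0 i = fun x => if ξ i ≤ x ∧ x < ξ (i + 1) then 1 else 0 := by
      funext x; rw [bspline]
    rw [h]
    refine Measurable.ite ?_ measurable_const measurable_const
    exact (measurableSet_le measurable_const measurable_id).inter
      (measurableSet_lt measurable_id measurable_const)
  | succ q ih =>
    have h1 := ih i
    have h2 := ih (i + 1)
    have h : bspline ξ (q + 1) i = fun x =>
        (x - ξ i) / (ξ (i + q + 1) - ξ i) * bspline ξ q i x +
          (ξ (i + q + 2) - x) / (ξ (i + q + 2) - ξ (i + 1)) * bspline ξ q (i + 1) x := by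
      funext x; rw [bspline]
    rw [h]
    fun_prop

lemma bspline_bounded (ξ : ℕ → ℝ) (q i : ℕ) :
    ∃ C : ℝ, ∀ x ∈ Icc (0 : ℝ) 1, |bspline ξ q i x| ≤ C := by
  induction q generalizing i with
  | zero =>
    refine ⟨1, fun x _ => ?_⟩
    unfold bspline
    split_ifs <;> simp
  | succ q ih =>
    obtain ⟨C1, h1⟩ := ih i
    obtain ⟨C2, h2⟩ := ih (i + 1)
    obtain ⟨A1, k1⟩ := isCompact_Icc.exists_bound_of_continuousOn (s := Icc (0 : ℝ) 1)
      (f := fun x : ℝ => (x - ξ i) / (ξ (i + q + 1) - ξ i)) (by fun_prop)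
    obtain ⟨A2, k2⟩ := isCompact_Icc.exists_bound_of_continuousOn (s := Icc (0 : ℝ) 1)
      (f := fun x : ℝ => (ξ (i + q + 2) - x) / (ξ (i + q + 2) - ξ (i + 1))) (by fun_prop)
    refine ⟨A1 * C1 + A2 * C2, fun x hx => ?_⟩
    unfold bspline
    refine (abs_add_le _ _).trans ?_
    rw [abs_mul, abs_mul]
    have := k1 x hx
    have := k2 x hx
    have := h1 x hx
    have := h2 x hx
    simp only [Real.norm_eq_abs] at *
    have ha : (0 : ℝ) ≤ A1 := (abs_nonneg _).trans ‹_›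
    have hb : (0 : ℝ) ≤ A2 := (abs_nonneg _).trans ‹_›
    gcongr

lemma measurable_beta (p n i j : ℕ) : Measurable (beta p n i j) := by
  have hP : Measurable paramInv := by unfold paramInv; fun_prop
  have hH : Measurable (bHat p n i j) := by
    have h1 := measurable_bspline (knot p n) p i
    have h2 := measurable_bspline (knot p (level p i)) p j
    have h3 : Measurable fun y : ℝ => (bernsteinPolynomial ℝ (i - 1) (j - 1)).eval y :=
      (Polynomial.continuous _).measurable
    unfold bHat b
    split_ifs
    · exact (h1.comp measurable_fst).mul (h3.comp measurable_snd)
    · exact (h1.comp measurable_fst).mul (h2.comp measurable_snd)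
  exact hH.comp hP

lemma beta_memLp (p n i j : ℕ) {γ : ℝ} (hγ : γ ≤ 1) :
    MemLp (beta p n i j) 2 ((volume : Measure (ℝ × ℝ)).restrict (tri γ)) := by
  have : IsFiniteMeasure ((volume : Measure (ℝ × ℝ)).restrict (tri γ)) :=
    ⟨by rw [Measure.restrict_apply_univ]; exact volume_tri_lt_top⟩
  obtain ⟨C1, h1⟩ := bspline_bounded (knot p n) p i
  obtain ⟨C2, h2⟩ := bspline_bounded (knot p (level p i)) p j
  obtain ⟨C3, h3⟩ := isCompact_Icc.exists_bound_of_continuousOn (s := Icc (0 : ℝ) 1)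
      (f := fun y : ℝ => (bernsteinPolynomial ℝ (i - 1) (j - 1)).eval y)
      (Polynomial.continuous _).continuousOn
  refine MemLp.of_bound (measurable_beta p n i j).aestronglyMeasurable (C1 * max C2 C3) ?_
  filter_upwards [ae_restrict_mem (measurableSet_tri γ)] with x hx
  obtain ⟨ha, hb, hc, hd⟩ := hx
  have hu : x.1 ∈ Icc (0 : ℝ) 1 := ⟨ha.le, by linarith⟩
  have hv : x.2 / x.1 ∈ Icc (0 : ℝ) 1 := ⟨by positivity, (div_le_one ha).2 hd.le⟩
  have e1 := h1 _ hu
  have e2 := (h2 _ hv).trans (le_max_left C2 C3)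
  have e3 := (h3 _ hv).trans (le_max_right C2 C3)
  have hC : (0 : ℝ) ≤ C1 := (abs_nonneg _).trans e1
  simp only [Real.norm_eq_abs] at e3
  rw [Real.norm_eq_abs]
  unfold beta bHat paramInv b
  split_ifs
  · rw [abs_mul]; gcongr
  · rw [abs_mul]; gcongr

/-- The class in `L²(Δ_{h₀})` of the coarse basis function `β^{n₀}_{i,j}`. -/
def betaCoarse (p i j : ℕ) : L2 (hZero p) :=
  (beta_memLp p (nZero p) i j (hZero_le_one p)).toLp _

/-- `μ` is a family of bounded functionals `μ^{n₀}_{k,l}` on `L²(Δ_{h₀})`, `1 ≤ k ≤ p + 1`,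
`1 ≤ l ≤ k`, dual to the basis: `μ^{n₀}_{k,l}(β^{n₀}_{i,j}) = 1` if `(i, j) = (k, l)`, and `0`
otherwise. -/
def IsCoarseDual (p : ℕ) (μ : ℕ → ℕ → L2 (hZero p) →L[ℝ] ℝ) : Prop :=
  ∀ k l : ℕ, 1 ≤ k → k ≤ p + 1 → 1 ≤ l → l ≤ k → ∀ q ∈ basisIndex p (nZero p),
    μ k l (betaCoarse p q.1 q.2) = if q = (k, l) then 1 else 0

/-! ### The projection -/

lemma scale_memLp {φ : ℝ × ℝ → ℝ} {c γ : ℝ} (hc : 0 < c) (hc1 : c ≤ 1) (hγ : γ ≤ 1)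
    (hφ : MemLp φ 2 ((volume : Measure (ℝ × ℝ)).restrict (tri 1))) :
    MemLp (fun x => φ (c • x)) 2 ((volume : Measure (ℝ × ℝ)).restrict (tri γ)) := by
  have hm : Measurable fun x : ℝ × ℝ => c • x := measurable_const_smul c
  have hsub : tri γ ⊆ (fun x : ℝ × ℝ => c • x) ⁻¹' tri 1 := by
    rintro ⟨u, v⟩ ⟨h1, h2, h3, h4⟩
    simp only [tri, mem_preimage, mem_ofPred_eq, Prod.smul_mk, smul_eq_mul] at *
    refine ⟨by positivity, by nlinarith, by positivity, by nlinarith⟩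
  have hle : (volume : Measure (ℝ × ℝ)).restrict (tri γ) ≤
      (volume : Measure (ℝ × ℝ)).restrict ((fun x : ℝ × ℝ => c • x) ⁻¹' tri 1) :=
    Measure.restrict_mono hsub le_rfl
  refine MemLp.mono_measure hle ?_
  have hmap : Measure.map (fun x : ℝ × ℝ => c • x)
      ((volume : Measure (ℝ × ℝ)).restrict ((fun x : ℝ × ℝ => c • x) ⁻¹' tri 1)) =
      ENNReal.ofReal |(c ^ Module.finrank ℝ (ℝ × ℝ))⁻¹| •
        (volume : Measure (ℝ × ℝ)).restrict (tri 1) := by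
    rw [← Measure.restrict_map hm (measurableSet_tri 1),
      Measure.map_addHaar_smul volume hc.ne', Measure.restrict_smul]
  have h2 : MemLp φ 2 (Measure.map (fun x : ℝ × ℝ => c • x)
      ((volume : Measure (ℝ × ℝ)).restrict ((fun x : ℝ × ℝ => c • x) ⁻¹' tri 1))) := by
    rw [hmap]
    exact hφ.smul_measure ENNReal.ofReal_ne_top
  exact h2.comp_of_map hm.aemeasurable

/-- The function `φ ∘ (2^{n₀-n} I)` in `L²(Δ_{h₀})`, for `φ ∈ L²(Δ)` and `n ≥ n₀`. -/
def rescale (p n : ℕ) (φ : L2 1) : L2 (hZero p) :=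
  (scale_memLp (c := (1 / 2 : ℝ) ^ (n - nZero p)) (by positivity)
    (pow_le_one₀ (by norm_num) (by norm_num)) (hZero_le_one p) (Lp.memLp φ)).toLp _

/-- The dual functionals `Λ^n_{k,l}` on `L²(Δ)`, for `n ≥ n₀`. -/
def Lam (p : ℕ) (μ : ℕ → ℕ → L2 (hZero p) →L[ℝ] ℝ) (n k l : ℕ) (φ : L2 1) : ℝ :=
  if k ≤ p + 1 then μ k l (rescale p n φ)
  else tensorDual p n k (level p k) l fun x => φ (param x)

/-- The projection `Π φ = ∑_{k,l} Λ^n_{k,l}(φ) β^n_{k,l}` onto the hierarchical spline space. -/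
def proj (p : ℕ) (μ : ℕ → ℕ → L2 (hZero p) →L[ℝ] ℝ) (n : ℕ) (φ : L2 1) (x : ℝ × ℝ) : ℝ :=
  ∑ k ∈ Finset.Icc 1 (2 ^ n + p), ∑ l ∈ Finset.Icc 1 (numCols p k),
    Lam p μ n k l φ * beta p n k l x

end

end HierSpline

/-!
The estimate reduces to one bound for the dual functionals,
`|Λ_{k,l}(φ)| ≤ C 2 ^ n ‖φ‖_{L²(supp β_{k,l})}` (`exists_enorm_Lam_le`). Given this bound, only the
basis functions that do not vanish at a point `x` of an element `δ` contribute to `Π φ` at `x`, and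
their supports lie in the support extension. The basis functions are nonnegative with sum at most
one, so `|Π φ| ≤ C 2 ^ n ‖φ‖` pointwise on `δ`, with the norm over the support extension
(`enorm_proj_le`). Every element of the hierarchical mesh has area at most `4 ^ (-n)`
(`measurableSet_and_volume_le_of_mem_hierMesh`), and integration over `δ` cancels the factor
`2 ^ n`.

For `k ≤ p + 1`, the bound on `Λ_{k,l}` follows by scaling the plane by `2 ^ (n₀ - n)`, which maps
the coarse triangle onto `Δ_{2^{-n}}` (`enorm_apply_rescale_le`); the support of `β_{k,l}` contains that
triangle because B-splines and Bernstein polynomials are positive inside their supports.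

For `k ≥ p + 2`, the densities of the univariate functionals are bounded by `C 2 ^ n` and `C 2 ^ m`
(`exists_iteratedDeriv_dualPsi_le`), where `m` is the level in the second variable, and the functional
acts on a box `R` of area at most `C 2 ^ (-n-m)`. The Cauchy–Schwarz inequality gives
`|Λ_{k,l}(φ)| ≤ C 2 ^ ((n+m)/2) ‖φ ∘ u‖_{L²(R)}`. Since `m` is the level determined by the distance to
the singular edge, the Jacobian `s` of the parameterization `u` is at least `2 ^ (m-n-1)` on `R`, and
passing to the triangle contributes the factor `2 ^ ((n-m+1)/2)`, so that the dependence on `m`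
disappears (`exists_enorm_tensorDual_comp_param_le`).
-/

namespace HierSpline

/-! ### Univariate B-splines -/

lemma bspline_eq_zero_of_notMem {ξ : ℕ → ℝ} (hξ : Monotone ξ) (q i : ℕ) {x : ℝ}
    (hx : ¬ (ξ i ≤ x ∧ x < ξ (i + q + 1))) : bspline ξ q i x = 0 := by
  induction q generalizing i with
  | zero => rw [bspline, if_neg hx]
  | succ q ih =>
    have h1 : bspline ξ q i x = 0 :=
      ih i fun h => hx ⟨h.1, h.2.trans_le (hξ (by omega))⟩
    have h2 : bspline ξ q (i + 1) x = 0 :=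
      ih (i + 1) fun h => hx ⟨(hξ (by omega)).trans h.1, h.2.trans_le (hξ (by omega))⟩
    rw [bspline, h1, h2, mul_zero, mul_zero, add_zero]

lemma bspline_nonneg {ξ : ℕ → ℝ} (hξ : Monotone ξ) (q i : ℕ) (x : ℝ) : 0 ≤ bspline ξ q i x := by
  induction q generalizing i with
  | zero => rw [bspline]; split_ifs <;> norm_num
  | succ q ih =>
    by_cases hx : ξ i ≤ x ∧ x < ξ (i + (q + 1) + 1)
    · rw [bspline]
      have h1 : 0 ≤ ξ (i + q + 1) - ξ i := sub_nonneg.2 (hξ (by omega))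
      have h2 : 0 ≤ ξ (i + q + 2) - ξ (i + 1) := sub_nonneg.2 (hξ (by omega))
      have h3 : 0 ≤ x - ξ i := sub_nonneg.2 hx.1
      have h4 : 0 ≤ ξ (i + q + 2) - x := sub_nonneg.2 hx.2.le
      have h5 := ih i
      have h6 := ih (i + 1)
      positivity
    · rw [bspline_eq_zero_of_notMem hξ _ _ hx]

/-- A B-spline is positive inside its support. The alternative `ξ (i + q) ≤ x` covers the left
endpoint of the support when it is a knot of full multiplicity, which the induction needs. -/
lemma bspline_pos {ξ : ℕ → ℝ} (hξ : Monotone ξ) (q i : ℕ) {x : ℝ}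
    (h1 : ξ i < x ∨ ξ (i + q) ≤ x) (h2 : x < ξ (i + q + 1)) : 0 < bspline ξ q i x := by
  induction q generalizing i with
  | zero =>
    have : ξ i ≤ x := h1.elim le_of_lt id
    rw [bspline, if_pos ⟨this, h2⟩]
    norm_num
  | succ q ih =>
    have hx1 : ξ i ≤ x := h1.elim le_of_lt fun h => (hξ (by omega)).trans h
    have d1 : 0 ≤ ξ (i + q + 1) - ξ i := sub_nonneg.2 (hξ (by omega))
    have d2 : 0 ≤ ξ (i + q + 2) - ξ (i + 1) := sub_nonneg.2 (hξ (by omega))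
    have d3 : 0 ≤ x - ξ i := sub_nonneg.2 hx1
    have d4 : 0 < ξ (i + q + 2) - x := sub_pos.2 h2
    have d5 := bspline_nonneg hξ q i x
    have d6 := bspline_nonneg hξ q (i + 1) x
    rw [bspline]
    by_cases hx : x < ξ (i + q + 1)
    · have hi : ξ i < x := h1.resolve_right (not_le.2 hx)
      have := ih i (Or.inl hi) hx
      have e1 : 0 < x - ξ i := sub_pos.2 hi
      have e2 : 0 < ξ (i + q + 1) - ξ i := by linarith
      refine add_pos_of_pos_of_nonneg (by positivity) (by positivity)
    · push Not at hx
      have e0 : ξ (i + 1) ≤ ξ (i + q + 1) := hξ (by omega)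
      have e := ih (i + 1) (Or.inr (by rwa [show i + 1 + q = i + q + 1 by ring]))
        (by rwa [show i + 1 + q + 1 = i + (q + 1) + 1 by ring])
      have e2 : 0 < ξ (i + q + 2) - ξ (i + 1) := by linarith
      refine add_pos_of_nonneg_of_pos (by positivity) (by positivity)

lemma sum_range_bspline_le_one {ξ : ℕ → ℝ} (hξ : Monotone ξ) (q N : ℕ) (x : ℝ) :
    ∑ i ∈ Finset.range N, bspline ξ q i x ≤ 1 := by
  induction q generalizing N with
  | zero =>
    suffices h : ∑ i ∈ Finset.range N, bspline ξ 0 i x ≤ if x < ξ N then 1 else 0 by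
      refine h.trans ?_
      split_ifs <;> norm_num
    induction N with
    | zero => simp only [Finset.range_zero, Finset.sum_empty]; split_ifs <;> norm_num
    | succ N ih =>
      rw [Finset.sum_range_succ, bspline]
      have hN : ξ N ≤ ξ (N + 1) := hξ (by omega)
      by_cases h1 : x < ξ N
      · rw [if_pos h1] at ih
        rw [if_neg (fun h => (not_le.2 h1) h.1), if_pos (h1.trans_le hN)]
        linarith
      · rw [if_neg h1] at ih
        by_cases h2 : x < ξ (N + 1)
        · rw [if_pos ⟨not_lt.1 h1, h2⟩, if_pos h2]; linarith
        · rw [if_neg (fun h => h2 h.2), if_neg h2]; linarith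
  | succ q ih =>
    -- The two coefficients of the same B-spline of degree `q` add up to at most one.
    have key : ∀ i, 0 ≤ (x - ξ i) / (ξ (i + q + 1) - ξ i) * bspline ξ q i x ∧
        0 ≤ (ξ (i + q + 1) - x) / (ξ (i + q + 1) - ξ i) * bspline ξ q i x ∧
        (x - ξ i) / (ξ (i + q + 1) - ξ i) * bspline ξ q i x +
          (ξ (i + q + 1) - x) / (ξ (i + q + 1) - ξ i) * bspline ξ q i x ≤ bspline ξ q i x := by
      intro i
      by_cases hx : ξ i ≤ x ∧ x < ξ (i + q + 1)
      · have h1 : 0 ≤ x - ξ i := sub_nonneg.2 hx.1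
        have h2 : 0 < ξ (i + q + 1) - x := sub_pos.2 hx.2
        have h3 : 0 < ξ (i + q + 1) - ξ i := by linarith
        have h4 := bspline_nonneg hξ q i x
        refine ⟨by positivity, by positivity, le_of_eq ?_⟩
        field_simp
        ring
      · simp [bspline_eq_zero_of_notMem hξ q i hx]
    calc ∑ i ∈ Finset.range N, bspline ξ (q + 1) i x
        = ∑ i ∈ Finset.range N, (x - ξ i) / (ξ (i + q + 1) - ξ i) * bspline ξ q i x +
          ∑ i ∈ Finset.range N, (ξ (i + 1 + q + 1) - x) / (ξ (i + 1 + q + 1) - ξ (i + 1)) *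
            bspline ξ q (i + 1) x := by
          rw [← Finset.sum_add_distrib]
          refine Finset.sum_congr rfl fun i _ => ?_
          rw [bspline, show i + 1 + q + 1 = i + q + 2 by ring]
      _ ≤ ∑ i ∈ Finset.range (N + 1), (x - ξ i) / (ξ (i + q + 1) - ξ i) * bspline ξ q i x +
          ∑ i ∈ Finset.range (N + 1), (ξ (i + q + 1) - x) / (ξ (i + q + 1) - ξ i) *
            bspline ξ q i x := by
          refine add_le_add ?_ ?_
          · rw [Finset.sum_range_succ]
            exact le_add_of_nonneg_right (key N).1
          · rw [Finset.sum_range_succ' _ N]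
            exact le_add_of_nonneg_right (key 0).2.1
      _ ≤ ∑ i ∈ Finset.range (N + 1), bspline ξ q i x := by
          rw [← Finset.sum_add_distrib]
          exact Finset.sum_le_sum fun i _ => (key i).2.2
      _ ≤ 1 := ih (N + 1)

/-! ### The open knot vectors -/

lemma knot_mono (p n : ℕ) : Monotone (knot p n) := by
  intro i j hij
  unfold knot
  have : (i : ℝ) ≤ j := by exact_mod_cast hij
  gcongr

lemma knot_nonneg (p n i : ℕ) : 0 ≤ knot p n i := le_max_left _ _

lemma knot_le_one (p n i : ℕ) : knot p n i ≤ 1 := max_le zero_le_one (min_le_left _ _)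

lemma knot_eq_zero {p n i : ℕ} (hi : i ≤ p + 1) : knot p n i = 0 := by
  unfold knot
  have h : (i : ℝ) - (p + 1) ≤ 0 := by
    have : (i : ℝ) ≤ p + 1 := by exact_mod_cast hi
    linarith
  exact max_eq_left ((min_le_right _ _).trans (div_nonpos_of_nonpos_of_nonneg h (by positivity)))

lemma knot_add (p n k : ℕ) : knot p n (k + p + 1) = min 1 ((k : ℝ) / 2 ^ n) := by
  unfold knot
  have : ((k + p + 1 : ℕ) : ℝ) - (p + 1) = k := by push_cast; ring
  rw [this]
  exact max_eq_right (le_min zero_le_one (by positivity))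

lemma inv_le_knot_sub {p n k : ℕ} (hk : 1 ≤ k) (hk' : k ≤ 2 ^ n + p) :
    1 / 2 ^ n ≤ knot p n (k + p + 1) - knot p n k := by
  rw [knot_add, knot]
  have h2 : (0 : ℝ) < 2 ^ n := by positivity
  have h1 : (1 : ℝ) ≤ k := by exact_mod_cast hk
  have h3 : (k : ℝ) ≤ 2 ^ n + p := by exact_mod_cast hk'
  have h4 : (1 : ℝ) ≤ 2 ^ n := one_le_pow₀ (by norm_num)
  have hp : (0 : ℝ) ≤ p := by positivity
  rw [le_sub_iff_add_le, ← max_add_add_left, ← min_add_add_left]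
  refine max_le (le_min ?_ ?_) (le_min ?_ ?_)
  · rw [add_zero, div_le_one h2]; exact h4
  · rw [add_zero]; gcongr
  · refine (min_le_right _ _).trans ?_
    rw [← add_div, div_le_one h2]; linarith
  · refine (min_le_right _ _).trans ?_
    rw [← add_div]; gcongr; linarith

lemma knot_sub_le (p n k : ℕ) : knot p n (k + p + 1) - knot p n k ≤ (p + 1) / 2 ^ n := by
  rw [knot_add, knot]
  have h2 : (0 : ℝ) < 2 ^ n := by positivity
  have hp : (0 : ℝ) ≤ ((p : ℝ) + 1) / 2 ^ n := by positivity
  rcases le_total 1 (((k : ℝ) - (p + 1)) / 2 ^ n) with h | h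
  · have : min 1 ((k : ℝ) / 2 ^ n) ≤ 1 := min_le_left _ _
    have : (1 : ℝ) ≤ max 0 (min 1 (((k : ℝ) - (p + 1)) / 2 ^ n)) :=
      le_max_of_le_right (le_min le_rfl h)
    linarith
  · have h1 : min 1 ((k : ℝ) / 2 ^ n) ≤ k / 2 ^ n := min_le_right _ _
    have h3 : ((k : ℝ) - (p + 1)) / 2 ^ n ≤ max 0 (min 1 (((k : ℝ) - (p + 1)) / 2 ^ n)) :=
      le_max_of_le_right (le_min h le_rfl)
    have h5 := sub_div (k : ℝ) (p + 1) (2 ^ n)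
    linarith

lemma b_nonneg (p n i : ℕ) (x : ℝ) : 0 ≤ b p n i x := bspline_nonneg (knot_mono p n) p i x

lemma b_pos {p n i : ℕ} {x : ℝ} (hx : x ∈ Ioo (knot p n i) (knot p n (i + p + 1))) :
    0 < b p n i x := bspline_pos (knot_mono p n) p i (Or.inl hx.1) hx.2

lemma sum_Icc_b_le_one (p n N : ℕ) (x : ℝ) : ∑ i ∈ Finset.Icc 1 N, b p n i x ≤ 1 :=
  (Finset.sum_le_sum_of_subset_of_nonneg
    (fun _ hi => Finset.mem_range.2 (Nat.lt_succ_of_le (Finset.mem_Icc.1 hi).2))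
    fun i _ _ => b_nonneg p n i x).trans (sum_range_bspline_le_one (knot_mono p n) p (N + 1) x)

/-! ### Derivatives of the functions defining the dual functionals -/

/-- `f` is smooth on `U` and its derivative of each order `j` is bounded there by `c j`. -/
def HasDerivBounds (U : Set ℝ) (f : ℝ → ℝ) (c : ℕ → ℝ) : Prop :=
  ContDiffOn ℝ (⊤ : ℕ∞) f U ∧ ∀ j, ∀ y ∈ U, |iteratedDeriv j f y| ≤ c j

namespace HasDerivBounds

variable {U : Set ℝ} {f g : ℝ → ℝ} {c d : ℕ → ℝ}

lemma contDiffAt (hf : HasDerivBounds U f c) (hU : IsOpen U) {y : ℝ} (hy : y ∈ U) (j : ℕ) :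
    ContDiffAt ℝ j f y :=
  (hf.1.contDiffAt (hU.mem_nhds hy)).of_le (by exact_mod_cast le_top)

lemma add (hU : IsOpen U) (hf : HasDerivBounds U f c) (hg : HasDerivBounds U g d) :
    HasDerivBounds U (fun y => f y + g y) (fun j => c j + d j) := by
  refine ⟨hf.1.add hg.1, fun j y hy => ?_⟩
  rw [iteratedDeriv_fun_add (hf.contDiffAt hU hy j) (hg.contDiffAt hU hy j)]
  exact (abs_add_le _ _).trans (add_le_add (hf.2 j y hy) (hg.2 j y hy))

lemma mul (hU : IsOpen U) (hf : HasDerivBounds U f c) (hg : HasDerivBounds U g d) :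
    HasDerivBounds U (fun y => f y * g y)
      (fun j => ∑ i ∈ Finset.range (j + 1), (j.choose i : ℝ) * c i * d (j - i)) := by
  refine ⟨hf.1.mul hg.1, fun j y hy => ?_⟩
  rw [iteratedDeriv_fun_mul (hf.contDiffAt hU hy j) (hg.contDiffAt hU hy j)]
  refine (Finset.abs_sum_le_sum_abs _ _).trans (Finset.sum_le_sum fun i _ => ?_)
  rw [abs_mul, abs_mul, Nat.abs_cast]
  have h1 := hf.2 i y hy
  have h2 := hg.2 (j - i) y hy
  have : 0 ≤ c i := (abs_nonneg _).trans h1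
  gcongr

end HasDerivBounds

lemma exists_hasDerivBounds_of_contDiff {U : Set ℝ} (hU : U ⊆ Icc (-1) 1) {f : ℝ → ℝ}
    (hf : ContDiff ℝ (⊤ : ℕ∞) f) : ∃ c, HasDerivBounds U f c := by
  have h : ∀ j : ℕ, ∃ C : ℝ, ∀ y ∈ Icc (-1 : ℝ) 1, ‖iteratedDeriv j f y‖ ≤ C := fun j =>
    isCompact_Icc.exists_bound_of_continuousOn
      (hf.continuous_iteratedDeriv j (by exact_mod_cast le_top)).continuousOn
  choose c hc using h
  exact ⟨c, hf.contDiffOn, fun j y hy => hc j y (hU hy)⟩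

lemma hasDerivBounds_sub_const {U : Set ℝ} (hU : U ⊆ Icc (-1) 1) {η : ℝ} (hη : |η| ≤ 1) :
    HasDerivBounds U (fun y => y - η) (fun _ => 2) := by
  refine ⟨by fun_prop, fun j y hy => ?_⟩
  obtain ⟨h1, h2⟩ := hU hy
  obtain ⟨h3, h4⟩ := abs_le.1 hη
  rcases j with _ | j
  · rw [iteratedDeriv_zero, abs_le]; constructor <;> linarith
  · have : deriv (fun y : ℝ => y - η) = fun _ => 1 := by
      funext z; simp
    rw [iteratedDeriv_succ', this, iteratedDeriv_const]
    split_ifs <;> norm_num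

/-- The bounds `c` depend on the number of factors only, not on the zeros `η`. -/
lemma exists_hasDerivBounds_prod_sub {U : Set ℝ} (hUo : IsOpen U) (hU : U ⊆ Icc (-1) 1) (p : ℕ) :
    ∃ c, ∀ η : ℕ → ℝ, (∀ r ∈ Finset.Icc 1 p, |η r| ≤ 1) →
      HasDerivBounds U (fun y => ∏ r ∈ Finset.Icc 1 p, (y - η r)) c := by
  induction p with
  | zero =>
    obtain ⟨c, hc⟩ := exists_hasDerivBounds_of_contDiff hU (f := fun _ => (1 : ℝ)) contDiff_const
    exact ⟨c, fun η _ => by simpa using hc⟩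
  | succ p ih =>
    obtain ⟨c, hc⟩ := ih
    refine ⟨fun j => ∑ i ∈ Finset.range (j + 1), (j.choose i : ℝ) * c i * 2, fun η hη => ?_⟩
    have h := (hc η fun r hr => hη r (Finset.Icc_subset_Icc_right (by omega) hr)).mul hUo
      (hasDerivBounds_sub_const hU (hη (p + 1) (Finset.mem_Icc.2 ⟨by omega, le_rfl⟩)))
    simpa only [Finset.prod_Icc_succ_top (show 1 ≤ p + 1 by omega)] using h

lemma exists_hasDerivBounds_bspline (ξ : ℕ → ℝ) {U : Set ℝ} (hUo : IsOpen U)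
    (hU : U ⊆ Icc (-1) 1) (M : ℕ) (hξ : ∀ i ≤ M, ξ i ∉ U) (q i : ℕ) (hi : i + q + 1 ≤ M) :
    ∃ c, HasDerivBounds U (bspline ξ q i) c := by
  induction q generalizing i with
  | zero =>
    -- Away from the knots, a B-spline of degree zero is locally constant.
    have hloc : ∀ y ∈ U, bspline ξ 0 i =ᶠ[nhds y] fun _ => bspline ξ 0 i y := by
      intro y hy
      have h1 : ξ i ≠ y := fun h => hξ i (by omega) (h ▸ hy)
      have h2 : ξ (i + 1) ≠ y := fun h => hξ (i + 1) (by omega) (h ▸ hy)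
      have e1 : ∀ᶠ x in nhds y, (ξ i ≤ x ↔ ξ i ≤ y) := by
        rcases h1.lt_or_gt with h | h
        · filter_upwards [lt_mem_nhds h] with x hx
          exact ⟨fun _ => h.le, fun _ => le_of_lt hx⟩
        · filter_upwards [gt_mem_nhds h] with x hx
          exact ⟨fun k => absurd k (not_le.2 hx), fun k => absurd k (not_le.2 h)⟩
      have e2 : ∀ᶠ x in nhds y, (x < ξ (i + 1) ↔ y < ξ (i + 1)) := by
        rcases h2.lt_or_gt with h | h
        · filter_upwards [lt_mem_nhds h] with x hx
          exact ⟨fun k => absurd k (not_lt.2 (le_of_lt hx)), fun k => absurd k (not_lt.2 h.le)⟩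
        · filter_upwards [gt_mem_nhds h] with x hx
          exact ⟨fun _ => h, fun _ => hx⟩
      filter_upwards [e1, e2] with x h3 h4
      simp only [bspline, h3, h4]
    refine ⟨fun _ => 1, fun y hy =>
      (contDiffAt_const.congr_of_eventuallyEq (hloc y hy)).contDiffWithinAt, fun j y hy => ?_⟩
    rw [(hloc y hy).iteratedDeriv_eq, iteratedDeriv_const, bspline]
    split_ifs <;> norm_num
  | succ q ih =>
    obtain ⟨c1, h1⟩ := ih i (by omega)
    obtain ⟨c2, h2⟩ := ih (i + 1) (by omega)
    obtain ⟨d1, k1⟩ := exists_hasDerivBounds_of_contDiff hU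
      (f := fun x : ℝ => (x - ξ i) / (ξ (i + q + 1) - ξ i)) (by fun_prop)
    obtain ⟨d2, k2⟩ := exists_hasDerivBounds_of_contDiff hU
      (f := fun x : ℝ => (ξ (i + q + 2) - x) / (ξ (i + q + 2) - ξ (i + 1))) (by fun_prop)
    have h : bspline ξ (q + 1) i = fun x =>
        (x - ξ i) / (ξ (i + q + 1) - ξ i) * bspline ξ q i x +
          (ξ (i + q + 2) - x) / (ξ (i + q + 2) - ξ (i + 1)) * bspline ξ q (i + 1) x := by
      funext x; rw [bspline]
    rw [h]
    exact ⟨_, (k1.mul hUo h1).add hUo (k2.mul hUo h2)⟩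

lemma intervalIntegrable_bspline (ξ : ℕ → ℝ) (q i : ℕ) (x y : ℝ) :
    IntervalIntegrable (bspline ξ q i) volume x y := by
  induction q generalizing i with
  | zero =>
    refine (intervalIntegrable_const (c := (1 : ℝ))).mono_fun
      (measurable_bspline ξ 0 i).aestronglyMeasurable (Filter.Eventually.of_forall fun z => ?_)
    change ‖bspline ξ 0 i z‖ ≤ ‖(1 : ℝ)‖
    rw [bspline]
    split_ifs <;> simp
  | succ q ih =>
    have h : bspline ξ (q + 1) i = fun x =>
        (x - ξ i) / (ξ (i + q + 1) - ξ i) * bspline ξ q i x +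
          (ξ (i + q + 2) - x) / (ξ (i + q + 2) - ξ (i + 1)) * bspline ξ q (i + 1) x := by
      funext x; rw [bspline]
    rw [h]
    exact ((ih i).continuousOn_mul (by fun_prop)).add ((ih (i + 1)).continuousOn_mul (by fun_prop))

lemma exists_hasDerivBounds_transition (p : ℕ) {U : Set ℝ} (hUo : IsOpen U)
    (hU : U ⊆ Icc (-1) 1) (hξ : ∀ i ≤ p + 1, perfectKnot p i ∉ U) :
    ∃ c, HasDerivBounds U (transition p) c := by
  have hint : ∀ x y : ℝ, IntervalIntegrable (perfectBspline p) volume x y := fun x y =>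
    (intervalIntegrable_bspline (perfectKnot p) p 0 x y).const_mul _
  have hmeas : Measurable (perfectBspline p) :=
    (measurable_bspline (perfectKnot p) p 0).const_mul _
  obtain ⟨c0, h0⟩ := exists_hasDerivBounds_bspline (perfectKnot p) hUo hU (p + 1) hξ p 0 (by omega)
  obtain ⟨c1, h1⟩ := exists_hasDerivBounds_of_contDiff hU
    (f := fun _ => ((p : ℝ) + 1) / 2) contDiff_const
  obtain ⟨c, hc⟩ : ∃ c, HasDerivBounds U (perfectBspline p) c := ⟨_, h1.mul hUo h0⟩
  have hderiv : ∀ y ∈ U, HasDerivAt (transition p) (perfectBspline p y) y := fun y hy =>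
    intervalIntegral.integral_hasDerivAt_right (hint _ _)
      hmeas.stronglyMeasurable.stronglyMeasurableAtFilter
      (hc.contDiffAt hUo hy 0).continuousAt
  obtain ⟨A, hA⟩ := isCompact_Icc.exists_bound_of_continuousOn (s := Icc (-1 : ℝ) 1)
    (f := transition p) (intervalIntegral.continuous_primitive hint _).continuousOn
  have heq : EqOn (deriv (transition p)) (perfectBspline p) U := fun y hy => (hderiv y hy).deriv
  refine ⟨fun j => Nat.casesOn j A c, ?_, fun j y hy => ?_⟩
  · exact (contDiffOn_infty_iff_deriv_of_isOpen hUo).2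
      ⟨fun y hy => (hderiv y hy).differentiableAt.differentiableWithinAt, hc.1.congr heq⟩
  · rcases j with _ | j
    · exact hA y (hU hy)
    · rw [iteratedDeriv_succ', (heq.eventuallyEq_of_mem (hUo.mem_nhds hy)).iteratedDeriv_eq]
      exact hc.2 j y hy

lemma iteratedDeriv_comp_mul_add (f : ℝ → ℝ) (α β : ℝ) (j : ℕ) (x : ℝ) :
    iteratedDeriv j (fun x => f (α * x + β)) x = α ^ j * iteratedDeriv j f (α * x + β) := by
  induction j generalizing x with
  | zero => simp
  | succ j ih =>
    rw [iteratedDeriv_succ, funext ih, iteratedDeriv_succ, deriv_const_mul_field,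
      deriv_comp_mul_left α (fun z => iteratedDeriv j f (z + β)) x, deriv_comp_add_const, smul_eq_mul]
    ring

/-- The scaling bound `|D^{p+1} ψ| ≤ D / h` behind the stability of the dual functionals, with `h`
the length of the support of the B-spline. In the coordinate `y ∈ [-1,1]` on the support, `ψ` is
`h ^ p` times a function whose derivatives are bounded independently of the knots. The finitely many points that correspond to knots of the perfect B-spline
are left out, so that no smoothness of the transition function across its knots is needed. -/
lemma exists_iteratedDeriv_dualPsi_le (p : ℕ) :
    ∃ D : ℝ, 0 ≤ D ∧ ∀ n k : ℕ, knot p n k < knot p n (k + p + 1) →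
      ∀ᵐ x, x ∈ Ioo (knot p n k) (knot p n (k + p + 1)) →
        |iteratedDeriv (p + 1) (dualPsi p n k) x| ≤ D / (knot p n (k + p + 1) - knot p n k) := by
  set S : Set ℝ := perfectKnot p '' Iic (p + 1) with hS
  have hSf : S.Finite := (finite_Iic _).image _
  set U : Set ℝ := Ioo (-1) 1 \ S with hUdef
  have hUo : IsOpen U := isOpen_Ioo.sdiff hSf.isClosed
  have hU : U ⊆ Icc (-1) 1 := fun y hy => Ioo_subset_Icc_self hy.1
  obtain ⟨c1, h1⟩ := exists_hasDerivBounds_transition p hUo hU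
    fun i hi h => h.2 (mem_image_of_mem _ hi)
  obtain ⟨c2, h2⟩ := exists_hasDerivBounds_prod_sub hUo hU p
  set B : ℝ := ∑ i ∈ Finset.range (p + 1 + 1), ((p + 1).choose i : ℝ) * c1 i * c2 (p + 1 - i)
    with hB
  refine ⟨2 * |B| / p.factorial, by positivity, fun n k hk => ?_⟩
  set a := knot p n k with ha
  set a' := knot p n (k + p + 1) with ha'
  have hh : 0 < a' - a := sub_pos.2 hk
  set α := 2 / (a' - a) with hα
  set β := -(a + a') / (a' - a) with hβ
  have hα0 : 0 < α := by positivity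
  have hrange : ∀ x, (a ≤ x → -1 ≤ α * x + β) ∧ (x ≤ a' → α * x + β ≤ 1) ∧
      (a < x → -1 < α * x + β) ∧ (x < a' → α * x + β < 1) := by
    intro x
    have : α * x + β = (2 * x - a - a') / (a' - a) := by rw [hα, hβ]; field_simp; ring
    rw [this]
    refine ⟨fun h => ?_, fun h => ?_, fun h => ?_, fun h => ?_⟩
    · rw [le_div_iff₀ hh]; linarith
    · rw [div_le_iff₀ hh]; linarith
    · rw [lt_div_iff₀ hh]; linarith
    · rw [div_lt_iff₀ hh]; linarith
  set η : ℕ → ℝ := fun r => α * knot p n (k + r) + β with hη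
  have hη1 : ∀ r ∈ Finset.Icc 1 p, |η r| ≤ 1 := by
    intro r hr
    rw [Finset.mem_Icc] at hr
    exact abs_le.2 ⟨(hrange _).1 (knot_mono p n (by omega)),
      (hrange _).2.1 (knot_mono p n (by omega))⟩
  set G : ℝ → ℝ := fun y => transition p y * ∏ r ∈ Finset.Icc 1 p, (y - η r) with hGdef
  have hG : HasDerivBounds U G _ := h1.mul hUo (h2 η hη1)
  have hpsi : dualPsi p n k = fun x => (((a' - a) / 2) ^ p / p.factorial) * G (α * x + β) := by
    funext x
    have e1 : (2 * x - a - a') / (a' - a) = α * x + β := by rw [hα, hβ]; field_simp; ring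
    have e2 : ∏ r ∈ Finset.Icc 1 p, (x - knot p n (k + r)) =
        ((a' - a) / 2) ^ p * ∏ r ∈ Finset.Icc 1 p, (α * x + β - η r) := by
      have : ((a' - a) / 2) ^ p = ∏ r ∈ Finset.Icc 1 p, ((a' - a) / 2) := by
        rw [Finset.prod_const, Nat.card_Icc, Nat.add_sub_cancel]
      rw [this, ← Finset.prod_mul_distrib]
      refine Finset.prod_congr rfl fun r _ => ?_
      simp only [hη, hα]
      field_simp
      ring
    rw [dualPsi, ← ha, ← ha', e1, e2, hGdef]
    ring
  have hnull : ∀ᵐ x : ℝ, α * x + β ∉ S := by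
    have hfin : ((fun x : ℝ => α * x + β) ⁻¹' S).Finite :=
      hSf.preimage fun x _ y _ h => by
        simpa [hα0.ne'] using h
    exact measure_eq_zero_iff_ae_notMem.1 (hfin.measure_zero volume)
  filter_upwards [hnull] with x hx hxI
  have hy : α * x + β ∈ U := ⟨⟨(hrange x).2.2.1 hxI.1, (hrange x).2.2.2 hxI.2⟩, hx⟩
  have hGB : |iteratedDeriv (p + 1) G (α * x + β)| ≤ |B| :=
    (hG.2 (p + 1) _ hy).trans (le_abs_self _)
  rw [hpsi, iteratedDeriv_const_mul_field, iteratedDeriv_comp_mul_add G, abs_mul, abs_mul,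
    abs_of_pos (a := α ^ (p + 1)) (by positivity),
    abs_of_nonneg (a := ((a' - a) / 2) ^ p / p.factorial) (by positivity)]
  calc _ ≤ ((a' - a) / 2) ^ p / p.factorial * (α ^ (p + 1) * |B|) := by
        exact mul_le_mul_of_nonneg_left (mul_le_mul_of_nonneg_left hGB (by positivity))
          (by positivity)
    _ = ((a' - a) / 2 * α) ^ p * α * |B| / p.factorial := by rw [mul_pow]; ring
    _ = 2 * |B| / p.factorial / (a' - a) := by
        have : (a' - a) / 2 * α = 1 := by rw [hα]; field_simp
        rw [this, hα, one_pow]; ring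

/-! ### The singular parameterization -/

lemma continuous_param : Continuous param := by unfold param; fun_prop

lemma paramInv_param {x : ℝ × ℝ} (hx : 0 < x.1) : paramInv (param x) = x := by
  unfold paramInv param
  ext
  · rfl
  · exact mul_div_cancel_left₀ _ hx.ne'

lemma param_mem_tri_one {x : ℝ × ℝ} (h1 : x.1 ∈ Ioo (0 : ℝ) 1) (h2 : x.2 ∈ Ioo (0 : ℝ) 1) :
    param x ∈ tri 1 :=
  ⟨h1.1, h1.2, mul_pos h1.1 h2.1, mul_lt_of_lt_one_right h1.1 h2.2⟩

lemma injOn_param {S : Set (ℝ × ℝ)} (hS : ∀ x ∈ S, 0 < x.1) : InjOn param S := fun x hx y hy h => by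
  rw [← paramInv_param (hS x hx), h, paramInv_param (hS y hy)]

/-- The derivative `(a, b) ↦ (a, t a + s b)` of the parameterization at `(s, t)`. -/
noncomputable def fderivParam (x : ℝ × ℝ) : ℝ × ℝ →L[ℝ] ℝ × ℝ :=
  (Matrix.toLin (.finTwoProd ℝ) (.finTwoProd ℝ) !![1, 0; x.2, x.1]).toContinuousLinearMap

lemma hasFDerivAt_param (x : ℝ × ℝ) : HasFDerivAt param (fderivParam x) x := by
  unfold fderivParam
  rw [Matrix.toLin_finTwoProd_toContinuousLinearMap]
  convert! HasFDerivAt.prodMk (𝕜 := ℝ) (hasFDerivAt_fst (𝕜 := ℝ) (p := x))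
    ((hasFDerivAt_fst (𝕜 := ℝ) (p := x)).mul (hasFDerivAt_snd (𝕜 := ℝ) (p := x))) using 2 <;>
  simp [add_comm]

lemma det_fderivParam (x : ℝ × ℝ) : (fderivParam x).det = x.1 := by
  unfold fderivParam
  simp only [LinearMap.det_toContinuousLinearMap, LinearMap.det_toLin, Matrix.det_fin_two_of]
  ring

lemma lintegral_fst_eq_volume_image_param {S : Set (ℝ × ℝ)} (hS : MeasurableSet S)
    (hpos : ∀ x ∈ S, 0 < x.1) :
    ∫⁻ x in S, ENNReal.ofReal |x.1| = volume (param '' S) := by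
  rw [← lintegral_abs_det_fderiv_eq_addHaar_image volume hS
    (fun x _ => (hasFDerivAt_param x).hasFDerivWithinAt) (injOn_param hpos)]
  simp only [det_fderivParam]

lemma volume_image_param_le {S : Set (ℝ × ℝ)} (hS : MeasurableSet S)
    (hpos : ∀ x ∈ S, 0 < x.1) (hle : ∀ x ∈ S, x.1 ≤ 1) : volume (param '' S) ≤ volume S := by
  rw [← lintegral_fst_eq_volume_image_param hS hpos, ← setLIntegral_one]
  refine setLIntegral_mono' hS fun x hx => ?_
  rw [abs_of_pos (hpos x hx)]
  exact ENNReal.ofReal_le_one.2 (hle x hx)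

lemma mul_volume_le_volume_image_param {S : Set (ℝ × ℝ)} (hS : MeasurableSet S) {σ : ℝ}
    (hσ : 0 < σ) (hle : ∀ x ∈ S, σ ≤ x.1) :
    ENNReal.ofReal σ * volume S ≤ volume (param '' S) := by
  rw [← lintegral_fst_eq_volume_image_param hS fun x hx => hσ.trans_le (hle x hx),
    ← setLIntegral_const]
  refine setLIntegral_mono' hS fun x hx => ENNReal.ofReal_le_ofReal ?_
  exact (hle x hx).trans (le_abs_self _)

/-- At distance `σ` from the singular edge, composition with the parameterization is bounded in
`L²` with norm at most `σ ^ (-1/2)`. -/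
lemma eLpNorm_comp_param_le {φ : ℝ × ℝ → ℝ} (hφ : StronglyMeasurable φ) {R : Set (ℝ × ℝ)}
    (hR : MeasurableSet R) {σ : ℝ} (hσ : 0 < σ) (hle : ∀ x ∈ R, σ ≤ x.1) :
    eLpNorm (φ ∘ param) 2 (volume.restrict R) ≤
      ENNReal.ofReal σ⁻¹ ^ (1 / 2 : ℝ) * eLpNorm φ 2 (volume.restrict (param '' R)) := by
  have hm : Measurable param := continuous_param.measurable
  have hmap : Measure.map param (volume.restrict R) ≤
      ENNReal.ofReal σ⁻¹ • volume.restrict (param '' R) := by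
    refine Measure.le_iff.2 fun A hA => ?_
    rw [Measure.map_apply hm hA, Measure.restrict_apply (hm hA), Measure.smul_apply,
      Measure.restrict_apply hA, smul_eq_mul, ENNReal.ofReal_inv_of_pos hσ,
      ← ENNReal.mul_le_iff_le_inv (ENNReal.ofReal_pos.2 hσ).ne' ENNReal.ofReal_ne_top]
    refine (mul_volume_le_volume_image_param ((hm hA).inter hR) hσ fun x hx => hle x hx.2).trans
      (measure_mono ?_)
    rintro _ ⟨x, hx, rfl⟩
    exact ⟨hx.1, x, hx.2, rfl⟩
  rw [← eLpNorm_map_measure hφ.aestronglyMeasurable hm.aemeasurable]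
  refine (eLpNorm_mono_measure φ hmap).trans (le_of_eq ?_)
  rw [eLpNorm_smul_measure_of_ne_top (by norm_num), smul_eq_mul]
  norm_num

/-! ### Scaling and the hierarchical mesh -/

lemma preimage_smul_tri {c : ℝ} (hc : 0 < c) (γ : ℝ) :
    (fun x : ℝ × ℝ => c • x) ⁻¹' tri (c * γ) = tri γ := by
  ext x
  simp only [tri, mem_preimage, mem_ofPred_eq, Prod.smul_fst, Prod.smul_snd, smul_eq_mul]
  rw [mul_pos_iff_of_pos_left hc, mul_pos_iff_of_pos_left hc, mul_lt_mul_iff_right₀ hc,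
    mul_lt_mul_iff_right₀ hc]

lemma eLpNorm_comp_smul {φ : ℝ × ℝ → ℝ} (hφ : StronglyMeasurable φ) {c : ℝ} (hc : 0 < c) (γ : ℝ) :
    eLpNorm (fun x => φ (c • x)) 2 (volume.restrict (tri γ)) =
      ENNReal.ofReal c⁻¹ * eLpNorm φ 2 (volume.restrict (tri (c * γ))) := by
  have hm : Measurable fun x : ℝ × ℝ => c • x := measurable_const_smul c
  have hmap : Measure.map (fun x : ℝ × ℝ => c • x) (volume.restrict (tri γ)) =
      ENNReal.ofReal (c⁻¹ ^ 2) • volume.restrict (tri (c * γ)) := by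
    rw [← preimage_smul_tri hc, ← Measure.restrict_map hm (measurableSet_tri _),
      Measure.map_addHaar_smul volume hc.ne', Measure.restrict_smul, Module.finrank_prod,
      Module.finrank_self, ← inv_pow, abs_of_pos (by positivity)]
  have h := eLpNorm_map_measure (p := 2) (μ := volume.restrict (tri γ)) (f := fun x => c • x)
    hφ.aestronglyMeasurable hm.aemeasurable
  rw [← Function.comp_def φ, ← h, hmap, eLpNorm_smul_measure_of_ne_top (by norm_num), smul_eq_mul,
    ENNReal.ofReal_pow (by positivity), ← ENNReal.rpow_natCast_mul]
  norm_num

lemma measurableSet_and_volume_le_of_mem_hierMesh {n : ℕ} {δ : Set (ℝ × ℝ)}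
    (hδ : δ ∈ hierMesh n) :
    MeasurableSet δ ∧ δ ⊆ tri 1 ∧ volume δ ≤ ENNReal.ofReal ((1 / 2 ^ n) ^ 2) := by
  induction n generalizing δ with
  | zero =>
    rw [hierMesh, mem_singleton_iff] at hδ
    subst hδ
    refine ⟨measurableSet_tri 1, Subset.rfl, ?_⟩
    have h : tri 1 ⊆ Icc (0 : ℝ) 1 ×ˢ Icc (0 : ℝ) 1 := fun x hx =>
      ⟨⟨hx.1.le, hx.2.1.le⟩, hx.2.2.1.le, (hx.2.2.2.trans hx.2.1).le⟩
    refine (measure_mono h).trans ?_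
    rw [Measure.volume_eq_prod, Measure.prod_prod, Real.volume_Icc]
    norm_num
  | succ n ih =>
    rw [hierMesh] at hδ
    rcases hδ with ⟨⟨i, j, hi, hj, rfl⟩, hsub⟩ | ⟨δ', hδ', rfl⟩
    · set N : ℝ := 2 ^ (n + 1) with hN
      have hN0 : 0 < N := by positivity
      set Q := Ioo ((i : ℝ) / N) ((i + 1) / N) ×ˢ Ioo ((j : ℝ) / N) ((j + 1) / N) with hQ
      have hQm : MeasurableSet Q := measurableSet_Ioo.prod measurableSet_Ioo
      have hpos : ∀ x ∈ Q, 0 < x.1 := fun x hx => lt_of_le_of_lt (by positivity) hx.1.1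
      have hle : ∀ x ∈ Q, x.1 ≤ 1 := fun x hx => by
        refine hx.1.2.le.trans ((div_le_one hN0).2 ?_)
        have : i + 1 ≤ 2 ^ (n + 1) := hi
        rw [hN]
        exact_mod_cast this
      refine ⟨hQm.image_of_continuousOn_injOn continuous_param.continuousOn (injOn_param hpos),
        hsub.trans sdiff_subset, (volume_image_param_le hQm hpos hle).trans ?_⟩
      rw [hQ, Measure.volume_eq_prod, Measure.prod_prod, Real.volume_Ioo, Real.volume_Ioo,
        ← ENNReal.ofReal_mul (by rw [← sub_div]; simp [hN0.le])]
      refine ENNReal.ofReal_le_ofReal (le_of_eq ?_)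
      ring
    · obtain ⟨h1, h2, h3⟩ := ih hδ'
      rw [image_smul]
      refine ⟨h1.const_smul₀ _, ?_, ?_⟩
      · rintro _ ⟨x, hx, rfl⟩
        obtain ⟨a1, a2, a3, a4⟩ := h2 hx
        simp only [tri, mem_ofPred_eq, Prod.smul_fst, Prod.smul_snd, smul_eq_mul]
        refine ⟨?_, ?_, ?_, ?_⟩ <;> linarith
      · rw [Measure.addHaar_smul, Module.finrank_prod, Module.finrank_self]
        refine (mul_le_mul_right h3 _).trans ?_
        rw [← ENNReal.ofReal_mul (by positivity)]
        refine ENNReal.ofReal_le_ofReal (le_of_eq ?_)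
        rw [abs_of_pos (by positivity)]
        field_simp
        ring

/-! ### Local bounds for the dual functionals -/

lemma exists_enorm_dualFunctional_le (p : ℕ) :
    ∃ D : ℝ, 0 ≤ D ∧ ∀ n k : ℕ, 1 ≤ k → k ≤ 2 ^ n + p → ∀ f : ℝ → ℝ,
      ‖dualFunctional p n k f‖ₑ ≤
        ENNReal.ofReal (D * 2 ^ n) * ∫⁻ x in Ioo (knot p n k) (knot p n (k + p + 1)), ‖f x‖ₑ := by
  obtain ⟨D, hD, h⟩ := exists_iteratedDeriv_dualPsi_le p
  refine ⟨D, hD, fun n k hk hk' f => ?_⟩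
  have hlen := inv_le_knot_sub hk hk'
  have hlt : knot p n k < knot p n (k + p + 1) := by
    have : (0 : ℝ) < 1 / 2 ^ n := by positivity
    linarith
  rw [dualFunctional, intervalIntegral.integral_of_le hlt.le, integral_Ioc_eq_integral_Ioo,
    ← lintegral_const_mul' _ _ ENNReal.ofReal_ne_top]
  refine (enorm_integral_le_lintegral_enorm _).trans
    (lintegral_mono_ae ((ae_restrict_iff' measurableSet_Ioo).2 ?_))
  filter_upwards [h n k hlt] with x hx hxI
  rw [enorm_mul, mul_comm]
  gcongr
  rw [← ofReal_norm, Real.norm_eq_abs]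
  refine ENNReal.ofReal_le_ofReal ((hx hxI).trans ?_)
  have h2 : D / (knot p n (k + p + 1) - knot p n k) ≤ D / (1 / 2 ^ n) := by gcongr
  rwa [div_div_eq_mul_div, div_one] at h2

lemma exists_enorm_tensorDual_le (p : ℕ) :
    ∃ D : ℝ, 0 ≤ D ∧ ∀ n k m l : ℕ, 1 ≤ k → k ≤ 2 ^ n + p → 1 ≤ l → l ≤ 2 ^ m + p →
      ∀ F : ℝ × ℝ → ℝ, StronglyMeasurable F →
      ‖tensorDual p n k m l F‖ₑ ≤ ENNReal.ofReal (D * 2 ^ n) * (ENNReal.ofReal (D * 2 ^ m) *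
        ∫⁻ x in Ioo (knot p n k) (knot p n (k + p + 1)) ×ˢ
          Ioo (knot p m l) (knot p m (l + p + 1)), ‖F x‖ₑ) := by
  obtain ⟨D, hD, h⟩ := exists_enorm_dualFunctional_le p
  refine ⟨D, hD, fun n k m l hk hk' hl hl' F hF => (h n k hk hk' _).trans ?_⟩
  refine mul_le_mul_right ?_ _
  rw [Measure.volume_eq_prod, setLIntegral_prod _ hF.enorm.aemeasurable,
    ← lintegral_const_mul' _ _ ENNReal.ofReal_ne_top]
  exact lintegral_mono fun s => h m l hl hl' _

lemma two_pow_level_le {p k : ℕ} (hk : p + 2 ≤ k) : (2 : ℝ) ^ level p k / 2 ≤ k - (p + 1) := by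
  have h1 : 2 ≤ k - p := by omega
  have h2 : 2 ^ (level p k - 1) < k - p := Nat.pow_pred_clog_lt_self (by norm_num) h1
  have h3 : 1 ≤ level p k := Nat.clog_pos (by norm_num) h1
  have h4 : 2 ^ (level p k - 1) + (p + 1) ≤ k := by omega
  have h5 : (2 : ℝ) ^ (level p k - 1) + (p + 1) ≤ k := by exact_mod_cast h4
  have h6 : (2 : ℝ) ^ level p k = 2 ^ (level p k - 1) * 2 := by
    rw [← pow_succ, Nat.sub_add_cancel h3]
  linarith

/-- The box in parameter space over which the functionals of a B-spline product act is mapped into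
the support of the corresponding basis function. -/
lemma image_param_box_subset_betaSupport {p n k l : ℕ} (hk : p + 2 ≤ k) :
    param '' (Ioo (knot p n k) (knot p n (k + p + 1)) ×ˢ
      Ioo (knot p (level p k) l) (knot p (level p k) (l + p + 1))) ⊆ betaSupport p n k l := by
  rintro _ ⟨x, ⟨h1, h2⟩, rfl⟩
  have hx1 : x.1 ∈ Ioo (0 : ℝ) 1 :=
    ⟨(knot_nonneg p n k).trans_lt h1.1, h1.2.trans_le (knot_le_one _ _ _)⟩
  have hx2 : x.2 ∈ Ioo (0 : ℝ) 1 :=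
    ⟨(knot_nonneg p _ l).trans_lt h2.1, h2.2.trans_le (knot_le_one _ _ _)⟩
  have hm := param_mem_tri_one hx1 hx2
  refine ⟨subset_closure ⟨hm, ?_⟩, hm⟩
  rw [beta, paramInv_param hx1.1, bHat, if_neg (by omega)]
  exact (mul_pos (b_pos h1) (b_pos h2)).ne'

lemma bernsteinPolynomial_eval_pos {m j : ℕ} (hj : j ≤ m) {t : ℝ} (ht : t ∈ Ioo (0 : ℝ) 1) :
    0 < (bernsteinPolynomial ℝ m j).eval t := by
  have h1 : 0 < 1 - t := sub_pos.2 ht.2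
  have h2 : 0 < t := ht.1
  have h3 : (0 : ℝ) < m.choose j := by exact_mod_cast Nat.choose_pos hj
  simp only [bernsteinPolynomial, Polynomial.eval_mul, Polynomial.eval_pow, Polynomial.eval_sub,
    Polynomial.eval_natCast, Polynomial.eval_X, Polynomial.eval_one]
  positivity

lemma tri_subset_betaSupport {p n k l : ℕ} (hk : 1 ≤ k) (hkp : k ≤ p + 1) (hl : l ≤ k) :
    tri (1 / 2 ^ n) ⊆ betaSupport p n k l := by
  intro x hx
  obtain ⟨h1, h2, h3, h4⟩ := hx
  have hle : (1 : ℝ) / 2 ^ n ≤ 1 := div_le_one_of_le₀ (one_le_pow₀ (by norm_num)) (by positivity)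
  have hm : x ∈ tri 1 := ⟨h1, h2.trans_le hle, h3, h4⟩
  refine ⟨subset_closure ⟨hm, ?_⟩, hm⟩
  rw [beta, bHat, if_pos hkp]
  refine (mul_pos (b_pos ⟨?_, ?_⟩) (bernsteinPolynomial_eval_pos (by omega) ⟨?_, ?_⟩)).ne'
  · rw [knot_eq_zero hkp]; exact h1
  · refine h2.trans_le ?_
    have hk1 : (1 : ℝ) ≤ k := by exact_mod_cast hk
    rw [knot_add]
    exact le_min hle (by gcongr)
  · exact div_pos h3 h1
  · exact (div_lt_one h1).2 h4

/-- Stability of the functionals away from the singular vertex. On the box of the functional,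
`s ≥ 2 ^ (m - 1 - n)` for the level `m` in the second variable, so that the Jacobian of the
parameterization compensates the coarser mesh size `2 ^ (-m)`. -/
lemma exists_enorm_tensorDual_comp_param_le (p : ℕ) :
    ∃ C : ℝ, 0 ≤ C ∧ ∀ n k l : ℕ, p + 2 ≤ k → k ≤ 2 ^ n + p → 1 ≤ l → l ≤ 2 ^ level p k + p →
      ∀ φ : ℝ × ℝ → ℝ, StronglyMeasurable φ →
      ‖tensorDual p n k (level p k) l fun x => φ (param x)‖ₑ ≤
        ENNReal.ofReal (C * 2 ^ n) * eLpNorm φ 2 (volume.restrict (betaSupport p n k l)) := by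
  obtain ⟨D, hD, h⟩ := exists_enorm_tensorDual_le p
  refine ⟨D * D * (2 * (p + 1)), by positivity, fun n k l hk hk' hl hl' φ hφ => ?_⟩
  set m := level p k with hm
  set R : Set (ℝ × ℝ) := Ioo (knot p n k) (knot p n (k + p + 1)) ×ˢ
    Ioo (knot p m l) (knot p m (l + p + 1)) with hR
  have hRm : MeasurableSet R := measurableSet_Ioo.prod measurableSet_Ioo
  set σ : ℝ := 2 ^ m / 2 / 2 ^ n with hσ
  have hσ0 : 0 < σ := by positivity
  have hle : ∀ x ∈ R, σ ≤ x.1 := by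
    intro x hx
    refine le_trans ?_ hx.1.1.le
    have h1 : (k : ℝ) ≤ 2 ^ n + p := by exact_mod_cast hk'
    have h2 : σ ≤ ((k : ℝ) - (p + 1)) / 2 ^ n := by
      rw [hσ]
      gcongr
      exact two_pow_level_le hk
    have h3 : ((k : ℝ) - (p + 1)) / 2 ^ n ≤ 1 := (div_le_one (by positivity)).2 (by linarith)
    rw [knot, min_eq_right h3]
    exact le_max_of_le_right h2
  have hvol : volume R ≤ ENNReal.ofReal ((p + 1) / 2 ^ n * ((p + 1) / 2 ^ m)) := by
    rw [hR, Measure.volume_eq_prod, Measure.prod_prod, Real.volume_Ioo, Real.volume_Ioo,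
      ENNReal.ofReal_mul (by positivity)]
    gcongr
    · exact knot_sub_le p n k
    · exact knot_sub_le p m l
  have hF : StronglyMeasurable (φ ∘ param) := hφ.comp_measurable continuous_param.measurable
  have hcs : ∫⁻ x in R, ‖(φ ∘ param) x‖ₑ ≤
      eLpNorm (φ ∘ param) 2 (volume.restrict R) * volume R ^ (1 / 2 : ℝ) := by
    have := eLpNorm_le_eLpNorm_mul_rpow_measure_univ (p := 1) (q := 2)
      (μ := volume.restrict R) (by norm_num) hF.aestronglyMeasurable
    rw [eLpNorm_one_eq_lintegral_enorm, Measure.restrict_apply_univ] at this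
    convert this using 3
    norm_num
  have hnorm := (eLpNorm_comp_param_le hφ hRm hσ0 hle).trans (mul_le_mul_right
    (eLpNorm_mono_measure φ (Measure.restrict_mono
      (image_param_box_subset_betaSupport hk) le_rfl)) _)
  set E := eLpNorm φ 2 (volume.restrict (betaSupport p n k l)) with hE
  have hroot : ENNReal.ofReal σ⁻¹ ^ (1 / 2 : ℝ) * volume R ^ (1 / 2 : ℝ) ≤
      ENNReal.ofReal (2 * (p + 1) / 2 ^ m) := by
    rw [← ENNReal.mul_rpow_of_nonneg _ _ (by norm_num)]
    have hsq : ENNReal.ofReal σ⁻¹ * volume R ≤ ENNReal.ofReal (2 * (p + 1) / 2 ^ m) ^ (2 : ℝ) := by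
      refine (mul_le_mul_right hvol _).trans ?_
      rw [← ENNReal.ofReal_mul (by positivity), ENNReal.ofReal_rpow_of_nonneg (by positivity)
        (by norm_num), Real.rpow_two]
      refine ENNReal.ofReal_le_ofReal ?_
      have : σ⁻¹ * ((p + 1) / 2 ^ n * ((p + 1) / 2 ^ m)) = 2 * ((p + 1) / 2 ^ m) ^ 2 := by
        rw [hσ]; field_simp
      rw [this, mul_div_assoc, mul_pow]
      nlinarith [sq_nonneg (((p : ℝ) + 1) / 2 ^ m)]
    refine (ENNReal.rpow_le_rpow hsq (by norm_num)).trans (le_of_eq ?_)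
    rw [← ENNReal.rpow_mul]
    norm_num
  calc ‖tensorDual p n k m l fun x => φ (param x)‖ₑ
      ≤ ENNReal.ofReal (D * 2 ^ n) * (ENNReal.ofReal (D * 2 ^ m) *
          ∫⁻ x in R, ‖(φ ∘ param) x‖ₑ) := h n k m l (by omega) hk' hl hl' _ hF
    _ ≤ ENNReal.ofReal (D * 2 ^ n) * (ENNReal.ofReal (D * 2 ^ m) *
          ((ENNReal.ofReal σ⁻¹ ^ (1 / 2 : ℝ) * E) * volume R ^ (1 / 2 : ℝ))) := by
        gcongr
        exact hcs.trans (mul_le_mul_left hnorm _)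
    _ = ENNReal.ofReal (D * 2 ^ n) * ENNReal.ofReal (D * 2 ^ m) *
          (ENNReal.ofReal σ⁻¹ ^ (1 / 2 : ℝ) * volume R ^ (1 / 2 : ℝ)) * E := by ring
    _ ≤ ENNReal.ofReal (D * 2 ^ n) * ENNReal.ofReal (D * 2 ^ m) *
          ENNReal.ofReal (2 * (p + 1) / 2 ^ m) * E := by gcongr
    _ = ENNReal.ofReal (D * D * (2 * (p + 1)) * 2 ^ n) * E := by
        rw [← ENNReal.ofReal_mul (by positivity), ← ENNReal.ofReal_mul (by positivity)]
        congr 2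
        field_simp

/-- Stability of the functionals at the singular vertex, by scaling to the coarse level. -/
lemma enorm_apply_rescale_le {p n : ℕ} (hn : nZero p ≤ n) (ν : L2 (hZero p) →L[ℝ] ℝ) (φ : L2 1) :
    ‖ν (rescale p n φ)‖ₑ ≤
      ENNReal.ofReal (‖ν‖ * 2 ^ n) * eLpNorm φ 2 (volume.restrict (tri (1 / 2 ^ n))) := by
  set c : ℝ := (1 / 2) ^ (n - nZero p) with hc
  have hc0 : 0 < c := by positivity
  have hcγ : c * hZero p = 1 / 2 ^ n := by
    rw [hc, hZero, ← one_div_pow, ← one_div_pow, ← pow_add, Nat.sub_add_cancel hn]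
  have hcinv : c⁻¹ ≤ 2 ^ n := by
    rw [hc, one_div, inv_pow, inv_inv]
    exact pow_le_pow_right₀ (by norm_num) (Nat.sub_le _ _)
  have h1 : ‖rescale p n φ‖ₑ =
      ENNReal.ofReal c⁻¹ * eLpNorm φ 2 (volume.restrict (tri (1 / 2 ^ n))) := by
    rw [rescale, Lp.enorm_toLp, eLpNorm_comp_smul (Lp.stronglyMeasurable φ) hc0, hcγ]
  refine (ν.le_opENorm _).trans ?_
  rw [h1, ← mul_assoc, ← ofReal_norm, ← ENNReal.ofReal_mul (norm_nonneg _)]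
  gcongr

/-- A functional is bounded by `C * 2 ^ n` times the norm on the support of its basis function. -/
lemma exists_enorm_Lam_le (p : ℕ) (μ : ℕ → ℕ → L2 (hZero p) →L[ℝ] ℝ) :
    ∃ C : ℝ, 0 < C ∧ ∀ n : ℕ, nZero p ≤ n → ∀ φ : L2 1, ∀ k l : ℕ, (k, l) ∈ basisIndex p n →
      ‖Lam p μ n k l φ‖ₑ ≤
        ENNReal.ofReal (C * 2 ^ n) * eLpNorm φ 2 (volume.restrict (betaSupport p n k l)) := by
  obtain ⟨C, hC, h⟩ := exists_enorm_tensorDual_comp_param_le p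
  set M : ℝ := ∑ k ∈ Finset.range (p + 2), ∑ l ∈ Finset.range (p + 2), ‖μ k l‖ with hM
  have hM0 : 0 ≤ M := by positivity
  refine ⟨M + C + 1, by positivity, fun n hn φ k l ⟨hk, hk', hl, hl'⟩ => ?_⟩
  simp only at hk hk' hl hl'
  by_cases hkp : k ≤ p + 1
  · rw [numCols, if_pos hkp] at hl'
    have hμM : ‖μ k l‖ ≤ M :=
      (Finset.single_le_sum (f := fun l => ‖μ k l‖) (fun _ _ => norm_nonneg _)
        (Finset.mem_range.2 (by omega : l < p + 2))).trans
      (Finset.single_le_sum (f := fun k => ∑ l ∈ Finset.range (p + 2), ‖μ k l‖)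
        (fun _ _ => by positivity) (Finset.mem_range.2 (by omega : k < p + 2)))
    rw [Lam, if_pos hkp]
    refine (enorm_apply_rescale_le hn (μ k l) φ).trans (mul_le_mul' ?_ ?_)
    · gcongr
      linarith
    · exact eLpNorm_mono_measure _ (Measure.restrict_mono (tri_subset_betaSupport hk hkp hl') le_rfl)
  · rw [numCols, if_neg hkp] at hl'
    rw [Lam, if_neg hkp]
    refine (h n k l (by omega) hk' hl hl' φ (Lp.stronglyMeasurable φ)).trans ?_
    gcongr
    linarith

/-! ### The basis functions form a nonnegative family with sum at most one -/

lemma beta_nonneg {p n k l : ℕ} (hl : l ≤ numCols p k) {x : ℝ × ℝ} (hx : x ∈ tri 1) :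
    0 ≤ beta p n k l x := by
  rw [beta, bHat]
  split_ifs with hkp
  · rw [numCols, if_pos hkp] at hl
    exact mul_nonneg (b_nonneg _ _ _ _) (bernsteinPolynomial_eval_pos (by omega)
      ⟨div_pos hx.2.2.1 hx.1, (div_lt_one hx.1).2 hx.2.2.2⟩).le
  · exact mul_nonneg (b_nonneg _ _ _ _) (b_nonneg _ _ _ _)

lemma sum_beta_le_one (p n : ℕ) (x : ℝ × ℝ) :
    ∑ k ∈ Finset.Icc 1 (2 ^ n + p), ∑ l ∈ Finset.Icc 1 (numCols p k), beta p n k l x ≤ 1 := by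
  refine le_trans (Finset.sum_le_sum fun k hk => ?_) (sum_Icc_b_le_one p n (2 ^ n + p) x.1)
  have hk1 := (Finset.mem_Icc.1 hk).1
  by_cases hkp : k ≤ p + 1
  · have hB : ∑ l ∈ Finset.Icc 1 k,
        (bernsteinPolynomial ℝ (k - 1) (l - 1)).eval (x.2 / x.1) = 1 := by
      have h := congrArg (Polynomial.eval (x.2 / x.1)) (bernsteinPolynomial.sum ℝ (k - 1))
      rw [Polynomial.eval_finsetSum, Polynomial.eval_one, Nat.sub_add_cancel hk1] at h
      rw [← h, show Finset.Icc 1 k = Finset.Ico 1 (k + 1) by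
        ext l; simp only [Finset.mem_Icc, Finset.mem_Ico]; omega, Finset.sum_Ico_eq_sum_range]
      simp only [Nat.add_sub_cancel, Nat.add_sub_cancel_left]
    simp only [beta, bHat, if_pos hkp, numCols, paramInv]
    rw [← Finset.mul_sum, hB, mul_one]
  · simp only [beta, bHat, if_neg hkp, numCols, paramInv]
    rw [← Finset.mul_sum]
    exact mul_le_of_le_one_right (b_nonneg _ _ _ _) (sum_Icc_b_le_one _ _ _ _)

/-- The pointwise form of the stability estimate. Only the functionals of basis functions that do
not vanish at `x` contribute, and their supports lie in the support extension. -/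
lemma enorm_proj_le {p n : ℕ} {μ : ℕ → ℕ → L2 (hZero p) →L[ℝ] ℝ} {φ : L2 1} {K : ENNReal}
    {δ : Set (ℝ × ℝ)} (hδ : δ ⊆ tri 1)
    (hK : ∀ k l : ℕ, (k, l) ∈ basisIndex p n →
      ‖Lam p μ n k l φ‖ₑ ≤ K * eLpNorm φ 2 (volume.restrict (betaSupport p n k l)))
    {x : ℝ × ℝ} (hx : x ∈ δ) :
    ‖proj p μ n φ x‖ₑ ≤ K * eLpNorm φ 2 (volume.restrict (supportExtension p n δ)) := by
  set E := eLpNorm φ 2 (volume.restrict (supportExtension p n δ)) with hE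
  have hterm : ∀ k ∈ Finset.Icc 1 (2 ^ n + p), ∀ l ∈ Finset.Icc 1 (numCols p k),
      ‖Lam p μ n k l φ * beta p n k l x‖ₑ ≤ K * E * ENNReal.ofReal (beta p n k l x) := by
    intro k hk l hl
    rw [Finset.mem_Icc] at hk hl
    have hkl : (k, l) ∈ basisIndex p n := ⟨hk.1, hk.2, hl.1, hl.2⟩
    have h0 := beta_nonneg (n := n) hl.2 (hδ hx)
    by_cases hz : beta p n k l x = 0
    · simp [hz]
    · have hxs : x ∈ betaSupport p n k l := ⟨subset_closure ⟨hδ hx, hz⟩, hδ hx⟩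
      have hsub : betaSupport p n k l ⊆ supportExtension p n δ := fun y hy =>
        ⟨(k, l), hkl, ⟨x, hxs, hx⟩, hy⟩
      rw [enorm_mul, Real.enorm_of_nonneg h0]
      gcongr
      refine (hK k l hkl).trans ?_
      gcongr
      exact eLpNorm_mono_measure _ (Measure.restrict_mono hsub le_rfl)
  calc ‖proj p μ n φ x‖ₑ
      ≤ ∑ k ∈ Finset.Icc 1 (2 ^ n + p), ∑ l ∈ Finset.Icc 1 (numCols p k),
          K * E * ENNReal.ofReal (beta p n k l x) :=
        (enorm_sum_le _ _).trans (Finset.sum_le_sum fun k hk =>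
          (enorm_sum_le _ _).trans (Finset.sum_le_sum fun l hl => hterm k hk l hl))
    _ = K * E * ENNReal.ofReal (∑ k ∈ Finset.Icc 1 (2 ^ n + p),
          ∑ l ∈ Finset.Icc 1 (numCols p k), beta p n k l x) := by
        have h0 : ∀ k, ∀ l ∈ Finset.Icc 1 (numCols p k), 0 ≤ beta p n k l x := fun k l hl =>
          beta_nonneg (Finset.mem_Icc.1 hl).2 (hδ hx)
        rw [ENNReal.ofReal_sum_of_nonneg fun k _ => Finset.sum_nonneg (h0 k), Finset.mul_sum]
        refine Finset.sum_congr rfl fun k _ => ?_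
        rw [ENNReal.ofReal_sum_of_nonneg (h0 k), Finset.mul_sum]
    _ ≤ K * E * 1 := by
        gcongr
        exact ENNReal.ofReal_le_one.2 (sum_beta_le_one p n x)
    _ = K * E := mul_one _

end HierSpline

theorem mainTheorem1 (p : ℕ) (hp : 1 ≤ p)
    (μ : ℕ → ℕ → HierSpline.L2 (HierSpline.hZero p) →L[ℝ] ℝ)
    (hμ : HierSpline.IsCoarseDual p μ) :
    ∃ C : ℝ, 0 < C ∧ ∀ n : ℕ, HierSpline.nZero p ≤ n →
      ∀ φ : HierSpline.L2 1, ∀ δ ∈ HierSpline.hierMesh n,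
        eLpNorm (HierSpline.proj p μ n φ) 2 (volume.restrict δ) ≤
          ENNReal.ofReal C *
            eLpNorm φ 2 (volume.restrict (HierSpline.supportExtension p n δ)) := by
  obtain ⟨C, hC, h⟩ := HierSpline.exists_enorm_Lam_le p μ
  refine ⟨C, hC, fun n hn φ δ hδ => ?_⟩
  obtain ⟨hδm, hδs, hδv⟩ := HierSpline.measurableSet_and_volume_le_of_mem_hierMesh hδ
  have hpt := (ae_restrict_iff' (μ := volume) hδm).2 (Filter.Eventually.of_forall fun x hx =>
    HierSpline.enorm_proj_le (μ := μ) hδs (h n hn φ) hx)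
  refine (eLpNorm_le_of_ae_enorm_bound hpt).trans ?_
  set E := eLpNorm φ 2 (volume.restrict (HierSpline.supportExtension p n δ)) with hE
  -- The factor `2 ^ n` is absorbed by the square root of the area of the element.
  have hroot : volume δ ^ (2 : ENNReal).toReal⁻¹ ≤ ENNReal.ofReal (1 / 2 ^ n) := by
    refine (ENNReal.rpow_le_rpow hδv (by positivity)).trans (le_of_eq ?_)
    rw [ENNReal.ofReal_pow (by positivity), ← ENNReal.rpow_natCast_mul]
    norm_num
  rw [Measure.restrict_apply_univ, smul_eq_mul]
  calc ENNReal.ofReal (C * 2 ^ n) * E * volume δ ^ (2 : ENNReal).toReal⁻¹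
      ≤ ENNReal.ofReal (C * 2 ^ n) * E * ENNReal.ofReal (1 / 2 ^ n) := by gcongr
    _ = ENNReal.ofReal (C * 2 ^ n) * ENNReal.ofReal (1 / 2 ^ n) * E := by ring
    _ = ENNReal.ofReal C * E := by
        rw [← ENNReal.ofReal_mul (by positivity)]
        congr 2
        field_simp
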